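/- For $d\ge 2$ let the comb graph $\mathbb{K}^d$ have vertex set $\mathbb{Z}^d$ and edges $(z,z+e_i)$ for all $z\in\mathbb{Z}^d$ and $1\le i\le d-1$, together with $(z,z+e_d)$ for all $z$ with $z_1=0$, where $e_1,\dots,e_d$ are the standard basis vectors. Let $\mathbb{Z}^d_{[2]}$ be the graph with vertex set $\mathbb{Z}^d$ in which $x,y$ are joined whenever $0<\|x-y\|_\infty\le 2$. In site percolation with parameter $p\in[0,1]$ on a graph $H$, each vertex is open with probability $p$, independently of the others. An embedding of a graph $G$ in the open set of $H$ is an injective map from the vertices of $G$ to the open vertices of $H$ that maps neighbours in $G$ to neighbours in $H$, and $$p_c(G,H):=\inf\bigl\{p\in[0,1]:\mathbb{P}(\text{there is an embedding of } G \text{ in the open set of } H)>0\bigr\}.$$ **Theorem (Comb percolation).** For every $d\ge 2$, $p_c(\mathbb{K}^d,\mathbb{Z}^d_{[2]})<1$. Moreover, there is $p_0=p_0(d)<1$ such that for every $p\in(p_0,1]$, in site percolation on $\mathbb{Z}^d$ with parameter $p$, almost surely there is an injective map $f$ from $\mathbb{Z}^d$ to the set of open sites that is 2-Lipschitz on the comb,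 that is, $\|f(z)-f(w)\|_\infty\le 2$ whenever $z,w$ are neighbours in $\mathbb{K}^d$. -/

import Mathlib

open MeasureTheory ProbabilityTheory unitInterval

/-- `S` contains an embedded copy of `G`: there is an injective map from the vertices of `G` to
vertices of `H` lying in `S` that sends neighbours in `G` to neighbours in `H`. -/
def EmbedsInOpenSet {V W : Type*} (G : SimpleGraph V) (H : SimpleGraph W) (S : Set W) : Prop :=
  ∃ f : V → W, Function.Injective f ∧ (∀ v, f v ∈ S) ∧ ∀ v w, G.Adj v w → H.Adj (f v) (f w)

/-- Site percolation with parameter `p`, as the law of the random set of open vertices: each vertex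
is open with probability `p`, independently for different vertices. -/
noncomputable def sitePercolation (W : Type*) (p : I) : Measure (Set W) :=
  setBernoulli (Set.univ : Set W) p

/-- The critical probability for embedding `G` in the open set of site percolation on `H`. The
infimum is taken in the complete lattice `[0, 1]`, so that it is `1` for the empty set. -/
noncomputable def criticalProb {V W : Type*} (G : SimpleGraph V) (H : SimpleGraph W) : I :=
  sInf {p : I | 0 < sitePercolation W p {S | EmbedsInOpenSet G H S}}

/-- The spread-out lattice on `ℤ ^ d`: distinct vertices are joined if they are at `ℓ^∞` distance
at most `M` (the norm on `Fin d → ℤ` is the supremum norm). -/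
def spreadOutLattice (d M : ℕ) : SimpleGraph (Fin d → ℤ) where
  Adj x y := 0 < ‖x - y‖ ∧ ‖x - y‖ ≤ M
  symm := ⟨fun x y h => by rwa [norm_sub_rev]⟩
  loopless := ⟨fun x h => by simp at h⟩

/-- The comb graph on `ℤ ^ d` (coordinates are numbered `0, …, d - 1`): `z` is joined to `z + e_i`
for each `i` other than the last coordinate, and, if the first coordinate of `z` is zero, also for
the last coordinate `i`. -/
def combGraph (d : ℕ) : SimpleGraph (Fin d → ℤ) :=
  SimpleGraph.fromRel fun z w => ∃ i : Fin d, w = z + Pi.single i 1 ∧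
    (i.val + 1 < d ∨ (i.val + 1 = d ∧ ∀ j : Fin d, j.val = 0 → z j = 0))

/-! The last coordinate serves as height. The copies of `ℤ^(d-1)` become disjoint open Lipschitz
surfaces stacked in height, and the teeth run along a Lipschitz spine, a graph in the first
coordinate, on which consecutive surfaces are exactly two apart.

Layer `k` is the highest point reachable by a `Climb` from a spine point of height `2k'` with at
most `k - k'` free ascents (`exists_layers`). Maximality makes it open, Lipschitz and strictly
increasing in `k`. If no spine point is `Bad`, it never exceeds `2k`, so it has height exactly `2k`
at spine points of that height.

A bad site starts a walk most of whose steps find new closed sites. The region `Reached` absorbs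
every bad site next to it, while each of its points is paid for by a walk rich in closed sites. If
such walks are bounded (`SparseClosed`), the region is bounded in each column, and the graph just
above it is the spine (`SparseClosed.exists_spine`). Counting walks and Borel–Cantelli give
`SparseClosed` almost surely for `p` near 1 (`exists_param`). -/

namespace CombPercolation

/-! ### Walks with marked sites -/

section Walks

variable {ι : Type*}

/-- Every coordinate of `v` differs from that of `u` by at most `r`. -/
def Near (r : ℕ) (u v : ι → ℤ) : Prop := ∀ i, |v i - u i| ≤ r

lemma Near.symm {r : ℕ} {u v : ι → ℤ} (h : Near r u v) : Near r v u := fun i => by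
  rw [abs_sub_comm]; exact h i

lemma Near.refl (r : ℕ) (u : ι → ℤ) : Near r u u := fun i => by simp

lemma Near.trans {r s : ℕ} {u v w : ι → ℤ} (h : Near r u v) (h' : Near s v w) :
    Near (r + s) u w := fun i => by
  have h₁ := abs_le.1 (h i)
  have h₂ := abs_le.1 (h' i)
  push_cast
  exact abs_le.2 ⟨by linarith, by linarith⟩

lemma Near.mono {r s : ℕ} {u v : ι → ℤ} (h : Near r u v) (hrs : r ≤ s) : Near s u v :=
  fun i => (h i).trans (by exact_mod_cast hrs)

lemma Near.coord_le {r : ℕ} {u v : ι → ℤ} (h : Near r u v) (i : ι) : v i ≤ u i + r := by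
  have := abs_le.1 (h i); linarith

lemma Near.eq {u v : ι → ℤ} (h : Near 0 u v) : v = u := by
  funext i
  have := h i
  simp only [Nat.cast_zero, abs_nonpos_iff] at this
  linarith

lemma Near.exists_intermediate {r : ℕ} {u v : ι → ℤ} (h : Near (r + 1) u v) :
    ∃ w, Near r u w ∧ Near 1 w v := by
  have : ∀ i, ∃ x : ℤ, |x - u i| ≤ r ∧ |v i - x| ≤ 1 := fun i => by
    have := abs_le.1 (h i)
    push_cast at this
    rcases lt_trichotomy (v i) (u i) with h' | h' | h'
    · exact ⟨v i + 1, abs_le.2 ⟨by omega, by omega⟩, by simp⟩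
    · exact ⟨v i, by simp [h'], by simp⟩
    · exact ⟨v i - 1, abs_le.2 ⟨by omega, by omega⟩, by simp⟩
  choose w hw using this
  exact ⟨w, fun i => (hw i).1, fun i => by simpa using (hw i).2⟩

lemma near_add_single [DecidableEq ι] (v : ι → ℤ) (j : ι) : Near 1 v (v + Pi.single j 1) := fun i => by
  by_cases h : i = j
  · subst h; simp
  · simp [h]

variable [Fintype ι]

/-- `Walk u v n C`: there is a walk of `n` steps from `u` to `v`, each step changing every coordinate
by at most one, on which all the sites of `C` are visited. -/
inductive Walk (u : ι → ℤ) : (ι → ℤ) → ℕ → Finset (ι → ℤ) → Prop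
  | nil : Walk u u 0 ∅
  | step {v w : ι → ℤ} {n : ℕ} {C : Finset (ι → ℤ)} :
      Walk u v n C → Near 1 v w → Walk u w (n + 1) C
  | mark {v : ι → ℤ} {n : ℕ} {C : Finset (ι → ℤ)} : Walk u v n C → Walk u v n (insert v C)

lemma Walk.trans {u v w : ι → ℤ} {n m : ℕ} {C E : Finset (ι → ℤ)} (h : Walk u v n C)
    (h' : Walk v w m E) : Walk u w (n + m) (C ∪ E) := by
  induction h' with
  | nil => simpa using h
  | step _ hn ih => exact ih.step hn
  | mark _ ih => rw [Finset.union_insert]; exact ih.mark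

lemma Walk.symm {u v : ι → ℤ} {n : ℕ} {C : Finset (ι → ℤ)} (h : Walk u v n C) :
    Walk v u n C := by
  induction h with
  | nil => exact .nil
  | step _ hn ih => simpa [add_comm] using (Walk.nil.step hn.symm).trans ih
  | @mark v n C _ ih => simpa [← Finset.insert_eq] using (Walk.nil (u := v)).mark.trans ih

lemma Walk.of_near {r : ℕ} {u v : ι → ℤ} (h : Near r u v) : Walk u v r ∅ := by
  induction r generalizing v with
  | zero => rw [h.eq]; exact .nil
  | succ r ih =>
    obtain ⟨w, hw, hv⟩ := h.exists_intermediate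
    exact (ih hw).step hv

lemma Walk.near {u v : ι → ℤ} {n : ℕ} {C : Finset (ι → ℤ)} (h : Walk u v n C) : Near n u v := by
  induction h with
  | nil => exact .refl _ _
  | step _ hn ih => exact ih.trans hn
  | mark _ ih => exact ih

lemma Walk.near_of_mem {u v c : ι → ℤ} {n : ℕ} {C : Finset (ι → ℤ)} (h : Walk u v n C)
    (hc : c ∈ C) : Near n u c := by
  induction h with
  | nil => simp at hc
  | step _ _ ih => exact (ih hc).mono (Nat.le_succ _)
  | mark hw ih =>
    rcases Finset.mem_insert.1 hc with rfl | hc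
    · exact hw.near
    · exact ih hc

end Walks

/-! ### Climbs and bad sites -/

section Climbs

variable {ι : Type*} [Fintype ι] [DecidableEq ι]

/-- Paths in the lattice with height coordinate `j` which ascend either freely (`l` times) or by
leaving a closed site for the first time (the set of these sites is `C`), and which descend by
diagonal steps (`s` times). -/
inductive Climb (S : Set (ι → ℤ)) (j : ι) (u : ι → ℤ) :
    (ι → ℤ) → ℕ → ℕ → Finset (ι → ℤ) → Prop
  | nil : Climb S j u u 0 0 ∅
  | layer {v : ι → ℤ} {l s : ℕ} {C : Finset (ι → ℤ)} :
      Climb S j u v l s C → Climb S j u (v + Pi.single j 1) (l + 1) s C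
  | side {v w : ι → ℤ} {l s : ℕ} {C : Finset (ι → ℤ)} :
      Climb S j u v l s C → Near 1 v w → w j = v j - 1 → Climb S j u w l (s + 1) C
  | up {v : ι → ℤ} {l s : ℕ} {C : Finset (ι → ℤ)} :
      Climb S j u v l s C → v ∉ S → v ∉ C → Climb S j u (v + Pi.single j 1) l s (insert v C)

variable {S : Set (ι → ℤ)} {j : ι} {u v : ι → ℤ} {l s : ℕ} {C : Finset (ι → ℤ)}

lemma Climb.height (h : Climb S j u v l s C) : v j = u j + C.card + l - s := by
  induction h with
  | nil => simp
  | layer _ ih => simp [ih]; ring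
  | side _ _ h ih => rw [h, ih]; push_cast; ring
  | up _ _ hC ih => simp [ih, Finset.card_insert_of_notMem hC]; ring

lemma Climb.closed (h : Climb S j u v l s C) : ∀ c ∈ C, c ∉ S := by
  induction h with
  | nil => simp
  | layer _ ih => exact ih
  | side _ _ _ ih => exact ih
  | up _ hv _ ih => simpa [hv] using ih

lemma Climb.walk (h : Climb S j u v l s C) : Walk u v (C.card + l + s) C := by
  induction h with
  | nil => exact .nil
  | @layer v l s C _ ih =>
    rw [show C.card + (l + 1) + s = C.card + l + s + 1 by ring]
    exact ih.step (near_add_single _ _)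
  | side _ hn _ ih => exact ih.step hn
  | @up v l s C _ _ hC ih =>
    rw [Finset.card_insert_of_notMem hC, show C.card + 1 + l + s = C.card + l + s + 1 by ring]
    exact ih.mark.step (near_add_single _ _)

lemma Climb.exists_prefix {w : ι → ℤ} (h : Climb S j u v l s C) (hw : w ∈ C) :
    ∃ l' ≤ l, ∃ s' C', Climb S j u w l' s' C' ∧ w ∉ C' := by
  induction h with
  | nil => simp at hw
  | layer _ ih => obtain ⟨l', hl, h⟩ := ih hw; exact ⟨l', by omega, h⟩
  | side _ _ _ ih => exact ih hw
  | @up v l s C hv _ hC ih =>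
    rcases Finset.mem_insert.1 hw with rfl | hw
    · exact ⟨l, le_rfl, s, C, hv, hC⟩
    · exact ih hw

/-- If `v` was already used for an ascent, cut the path back to its first departure from `v`; this
never increases `l`. -/
lemma Climb.exists_up (h : Climb S j u v l s C) (hv : v ∉ S) :
    ∃ l' ≤ l, ∃ s' C', Climb S j u (v + Pi.single j 1) l' s' C' := by
  by_cases hC : v ∈ C
  · obtain ⟨l', hl, s', C', h', hC'⟩ := h.exists_prefix hC
    exact ⟨l', hl, s', _, h'.up hv hC'⟩
  · exact ⟨l, le_rfl, s, _, h.up hv hC⟩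

/-- Some path from `u` ascends more than twice the number of its free ascents. -/
def Bad (S : Set (ι → ℤ)) (j : ι) (u : ι → ℤ) : Prop :=
  ∃ v l s C, Climb S j u v l s C ∧ u j + 2 * l < v j

/-- The height gained is `|C| + l - s`, so exceeding `2l` forces `l + s < |C|`. -/
lemma Bad.exists_walk (h : Bad S j u) :
    ∃ v m C, Walk u v m C ∧ (∀ c ∈ C, c ∉ S) ∧ m < 2 * C.card := by
  obtain ⟨v, l, s, C, h, hlt⟩ := h
  have := h.height
  exact ⟨v, _, C, h.walk, h.closed, by omega⟩

end Climbs

/-! ### The spine above the reached region -/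

section Spine

variable {ι : Type*} [Fintype ι] (S : Set (ι → ℤ)) (i₀ : ι)

/-- `History S i₀ C n p`: exploring from the half space `{x | x i₀ ≤ 0}`, a walk of `n` steps ending
at `p` can visit the closed sites `C`; each excursion starts at a point where the surplus
`48 * C.card - n` is at least twice the coordinate `i₀`, and visits new closed sites at a high
rate. -/
inductive History : Finset (ι → ℤ) → ℕ → (ι → ℤ) → Prop
  | base {p : ι → ℤ} : p i₀ ≤ 0 → History ∅ 0 p
  | step {C E : Finset (ι → ℤ)} {n r m : ℕ} {p u v : ι → ℤ} :
      History C n p → Near r p u → n + r + 2 * u i₀ ≤ 48 * C.card → Walk u v m E →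
      (∀ c ∈ E, c ∉ S) → Disjoint C E → m ≤ 6 * E.card → History (C ∪ E) (n + r + m) v

/-- The region below the spine. -/
def Reached (u : ι → ℤ) : Prop :=
  ∃ C n p r, History S i₀ C n p ∧ Near r p u ∧ n + r + 2 * u i₀ ≤ 48 * C.card

variable {S i₀} {u v : ι → ℤ}

lemma History.exists_walk {C : Finset (ι → ℤ)} {n : ℕ} {p : ι → ℤ} (h : History S i₀ C n p) :
    ∃ b, b i₀ ≤ 0 ∧ Walk b p n C ∧ ∀ c ∈ C, c ∉ S := by
  induction h with
  | @base p hp => exact ⟨p, hp, .nil, by simp⟩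
  | step _ hr _ hE hcl _ _ ih =>
    obtain ⟨b, hb, hw, hC⟩ := ih
    refine ⟨b, hb, ?_, ?_⟩
    · simpa using (hw.trans (.of_near hr)).trans hE
    · intro c hc
      rcases Finset.mem_union.1 hc with hc | hc
      · exact hC c hc
      · exact hcl c hc

lemma reached_of_nonpos (h : u i₀ ≤ 0) : Reached S i₀ u :=
  ⟨∅, 0, u, 0, .base h, .refl _ _, by simp; omega⟩

lemma Reached.lower {r : ℕ} (h : Reached S i₀ u) (hv : Near r u v) (h₀ : v i₀ = u i₀ - r) :
    Reached S i₀ v := by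
  obtain ⟨C, n, p, q, hH, hq, hle⟩ := h
  exact ⟨C, n, p, q + r, hH, hq.trans hv, by push_cast; omega⟩

/-- Closed sites may not be counted twice, so go back to the first excursion meeting `E` and keep
the longer of the two walks. -/
lemma History.reached_of_inter {C E : Finset (ι → ℤ)} {n m : ℕ} {p : ι → ℤ}
    (h : History S i₀ C n p) (hw : Walk u v m E) (hE : ∀ c ∈ E, c ∉ S) (hm : m < 2 * E.card)
    (hCE : ¬ Disjoint C E) : Reached S i₀ u := by
  induction h with
  | base => simp at hCE
  | @step C E₁ n r m₁ p u₁ v₁ hH hr hle hw₁ hcl hdisj hm₁ ih =>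
    by_cases hC : Disjoint C E
    swap
    · exact ih hC
    have hE₁ : ¬ Disjoint E₁ E := fun h' => hCE (Finset.disjoint_union_left.2 ⟨hC, h'⟩)
    obtain ⟨w, hw₁', hw'⟩ := Finset.not_disjoint_iff.1 hE₁
    have huw : Near m u w := hw.near_of_mem hw'
    have hu₁w : Near m₁ u₁ w := hw₁.near_of_mem hw₁'
    have hu₁u : Near (m₁ + m) u₁ u := hu₁w.trans huw.symm
    have hcoord := hu₁u.coord_le i₀
    have hv₁u : Near (m₁ + m₁ + m) v₁ u := by
      rw [add_assoc]; exact hw₁.near.symm.trans hu₁u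
    push_cast at hcoord
    rcases le_or_gt m m₁ with hmm | hmm
    -- `4m₁` steps, plus twice a rise of at most `2m₁`, cost `8m₁ ≤ 48|E₁|`: hence 48 = 8 · 6.
    · refine ⟨_, _, v₁, 3 * m₁, hH.step hr hle hw₁ hcl hdisj hm₁, hv₁u.mono (by omega), ?_⟩
      rw [Finset.card_union_of_disjoint hdisj]
      push_cast
      omega
    -- `E` replaces `E₁`. The detour through `u` has `3m ≤ 6|E|` steps, the source of the constant
    -- 6.
    · have hw₂ : Walk u₁ v (2 * m + m) E := by
        simpa using (Walk.of_near (hu₁u.mono (by omega : m₁ + m ≤ 2 * m))).trans hw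
      refine ⟨_, _, v, m, hH.step hr hle hw₂ hE hC (by omega), hw.near.symm, ?_⟩
      rw [Finset.card_union_of_disjoint hC]
      push_cast
      omega

lemma Reached.of_bad [DecidableEq ι] {j : ι} (h : Reached S i₀ u) (hv : Near 1 u v) (hbad : Bad S j v) :
    Reached S i₀ v := by
  obtain ⟨C, n, p, r, hH, hr, hle⟩ := h
  obtain ⟨w, m, E, hw, hE, hm⟩ := hbad.exists_walk
  by_cases hC : Disjoint C E
  swap
  · exact hH.reached_of_inter hw hE hm hC
  have hw' : Walk u w (1 + m) E := by simpa using (Walk.of_near hv).trans hw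
  refine ⟨_, _, w, m, hH.step hr hle hw' hE hC (by omega), hw.near.symm, ?_⟩
  have := hv.coord_le i₀
  rw [Finset.card_union_of_disjoint hC]
  push_cast at this ⊢
  omega

/-- Long walks visit closed sites at a low rate. -/
def SparseClosed (S : Set (ι → ℤ)) : Prop :=
  ∀ u : ι → ℤ, ∃ N : ℕ, ∀ n ≥ N, ∀ v C, Walk u v n C → n ≤ 48 * C.card → ¬ ∀ c ∈ C, c ∉ S

/-- Go up the column and run the history backwards: the `x + r + n` steps fit within the budget
`48|C|`. -/
lemma SparseClosed.exists_bound [DecidableEq ι] (hS : SparseClosed S) (y : ι → ℤ) :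
    ∃ N : ℕ, ∀ x, Reached S i₀ (Function.update y i₀ x) → x ≤ N := by
  obtain ⟨N, hN⟩ := hS (Function.update y i₀ 0)
  refine ⟨N, fun x ⟨C, n, p, r, hH, hr, hle⟩ => ?_⟩
  by_contra! hx
  obtain ⟨k, rfl⟩ := Int.eq_ofNat_of_zero_le (by omega : 0 ≤ x)
  obtain ⟨b, -, hw, hC⟩ := hH.exists_walk
  have h₀ : Near k (Function.update y i₀ 0) (Function.update y i₀ (k : ℤ)) := fun i => by
    by_cases h : i = i₀
    · subst h; simp
    · simp [h]
  have hwalk := ((Walk.of_near h₀).trans (.of_near hr.symm)).trans hw.symm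
  simp only [Finset.union_empty, Finset.empty_union] at hwalk
  simp only [Function.update_self] at hle
  exact hN _ (by omega) _ _ hwalk (by omega) hC

/-- The spine: a Lipschitz graph over the coordinates other than `i₀` without bad sites. -/
lemma SparseClosed.exists_spine [DecidableEq ι] (hS : SparseClosed S) (i₀ j : ι) :
    ∃ G : (ι → ℤ) → ℤ, (∀ y, ¬ Bad S j (Function.update y i₀ (G y))) ∧
      ∀ (r : ℕ) (y y' : ι → ℤ), (∀ i, i ≠ i₀ → |y' i - y i| ≤ r) → |G y' - G y| ≤ r := by
  have hmax : ∀ y : ι → ℤ, ∃ g, Reached S i₀ (Function.update y i₀ g) ∧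
      ∀ x, Reached S i₀ (Function.update y i₀ x) → x ≤ g := fun y =>
    Int.exists_greatest_of_bdd (let ⟨N, hN⟩ := hS.exists_bound y; ⟨N, hN⟩)
      ⟨0, reached_of_nonpos (by simp)⟩
  choose g hg hgmax using hmax
  have key : ∀ (r : ℕ) (y y' : ι → ℤ), (∀ i, i ≠ i₀ → |y' i - y i| ≤ r) → g y - r ≤ g y' := by
    intro r y y' h
    refine hgmax y' _ ((hg y).lower (r := r) (fun i => ?_) (by simp))
    by_cases hi : i = i₀
    · subst hi; simp
    · simpa [hi] using h i hi
  -- A bad site one above the maximum would itself be reached.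
  refine ⟨fun y => g y + 1, fun y hbad => ?_, fun r y y' h => ?_⟩
  · have := hgmax y _ ((hg y).of_bad (fun i => ?_) hbad)
    · dsimp only at this
      omega
    · by_cases hi : i = i₀
      · subst hi; simp
      · simp [hi]
  · have h₁ := key r y y' h
    have h₂ := key r y' y fun i hi => by rw [abs_sub_comm]; exact h i hi
    dsimp only
    exact abs_le.2 ⟨by omega, by omega⟩

end Spine

/-! ### Stacked Lipschitz surfaces -/

section Layers

variable {ι : Type*} [Fintype ι] [DecidableEq ι] (S : Set (ι → ℤ)) (i₀ j : ι) (G : (ι → ℤ) → ℤ)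

/-- The point of height `h` in the column of `p` lies under layer `k`. -/
def UnderLayer (k : ℤ) (p : ι → ℤ) (h : ℤ) : Prop :=
  ∃ (y : ι → ℤ) (k' : ℤ) (l s : ℕ) (C : Finset (ι → ℤ)), y j = 2 * k' ∧ k' + l ≤ k ∧
    Climb S j (Function.update y i₀ (G y)) (Function.update p j h) l s C

variable {S i₀ j G} {k h : ℤ} {p : ι → ℤ}

lemma UnderLayer.le (hG : ∀ y, ¬ Bad S j (Function.update y i₀ (G y))) (hij : j ≠ i₀)
    (hU : UnderLayer S i₀ j G k p h) : h ≤ 2 * k := by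
  obtain ⟨y, k', l, s, C, hy, hk, hc⟩ := hU
  by_contra! hlt
  refine hG y ⟨_, l, s, C, hc, ?_⟩
  simp only [Function.update_self, Function.update_of_ne hij]
  omega

lemma UnderLayer.succ (hU : UnderLayer S i₀ j G k p h) : UnderLayer S i₀ j G (k + 1) p (h + 1) := by
  obtain ⟨y, k', l, s, C, hy, hk, hc⟩ := hU
  refine ⟨y, k', l + 1, s, C, hy, by push_cast; omega, ?_⟩
  convert hc.layer using 1
  funext i
  by_cases hi : i = j
  · subst hi; simp
  · simp [hi]

lemma UnderLayer.up (hU : UnderLayer S i₀ j G k p h) (hS : Function.update p j h ∉ S) :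
    UnderLayer S i₀ j G k p (h + 1) := by
  obtain ⟨y, k', l, s, C, hy, hk, hc⟩ := hU
  obtain ⟨l', hl, s', C', hc'⟩ := hc.exists_up hS
  refine ⟨y, k', l', s', C', hy, by omega, ?_⟩
  convert hc' using 1
  funext i
  by_cases hi : i = j
  · subst hi; simp
  · simp [hi]

lemma UnderLayer.lower {r : ℕ} {p' : ι → ℤ} (hU : UnderLayer S i₀ j G k p h)
    (hp : ∀ i, i ≠ j → |p' i - p i| ≤ r) : UnderLayer S i₀ j G k p' (h - r) := by
  induction r generalizing p' with
  | zero =>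
    obtain ⟨y, k', l, s, C, hy, hk, hc⟩ := hU
    have : Function.update p' j (h - (0 : ℕ)) = Function.update p j h := by
      funext i
      by_cases hi : i = j
      · subst hi; simp
      · have := hp i hi
        simp only [Nat.cast_zero, abs_nonpos_iff] at this
        simp [hi]; omega
    exact ⟨y, k', l, s, C, hy, hk, by rwa [this]⟩
  | succ r ih =>
    have hn : Near (r + 1) (Function.update p j 0) (Function.update p' j 0) := fun i => by
      by_cases hi : i = j
      · subst hi; simp; positivity
      · simpa [hi] using hp i hi
    obtain ⟨w, hw, hw'⟩ := hn.exists_intermediate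
    obtain ⟨y, k', l, s, C, hy, hk, hc⟩ := ih (p' := w) fun i hi => by
      simpa [hi] using hw i
    refine ⟨y, k', l, s + 1, C, hy, hk, hc.side (fun i => ?_) (by simp; ring)⟩
    by_cases hi : i = j
    · subst hi; simp
    · simpa [hi] using hw' i

lemma underLayer_spine (y : ι → ℤ) (hij : j ≠ i₀) (hy : y j = 2 * k) :
    UnderLayer S i₀ j G k (Function.update y i₀ (G y)) (2 * k) := by
  refine ⟨y, k, 0, 0, ∅, hy, by simp, ?_⟩
  rw [show 2 * k = Function.update y i₀ (G y) j by simp [hij, hy], Function.update_eq_self]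
  exact .nil

/-- A stack of disjoint open Lipschitz surfaces which meet the spine at spacing two. -/
lemma exists_layers (hG : ∀ y, ¬ Bad S j (Function.update y i₀ (G y)))
    (hij : j ≠ i₀) :
    ∃ L : ℤ → (ι → ℤ) → ℤ, (∀ k p, Function.update p j (L k p) ∈ S) ∧
      (∀ k (r : ℕ) (p p' : ι → ℤ), (∀ i, i ≠ j → |p' i - p i| ≤ r) → |L k p' - L k p| ≤ r) ∧
      (∀ p, StrictMono fun k => L k p) ∧
      ∀ k y, y j = 2 * k → L k (Function.update y i₀ (G y)) = 2 * k := by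
  have hmax : ∀ (k : ℤ) (p : ι → ℤ), ∃ h, UnderLayer S i₀ j G k p h ∧
      ∀ x, UnderLayer S i₀ j G k p x → x ≤ h := fun k p => by
    refine Int.exists_greatest_of_bdd ⟨2 * k, fun h hU => hU.le hG hij⟩ ?_
    set y := Function.update p j (2 * k)
    have hy := underLayer_spine (S := S) (G := G) (k := k) y hij (by simp [y])
    refine ⟨_, hy.lower (r := ∑ i, (p i - Function.update y i₀ (G y) i).natAbs) fun i _ => ?_⟩
    rw [Int.abs_eq_natAbs]
    exact_mod_cast Finset.single_le_sum
      (f := fun i => (p i - Function.update y i₀ (G y) i).natAbs)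
      (fun _ _ => Nat.zero_le _) (Finset.mem_univ i)
  choose L hL hLmax using hmax
  refine ⟨L, fun k p => ?_, fun k r p p' h => ?_, fun p => ?_, fun k y hy => ?_⟩
  · by_contra hS
    have := hLmax k p _ ((hL k p).up hS)
    omega
  · have h₁ := hLmax k p' _ ((hL k p).lower h)
    have h₂ := hLmax k p _ ((hL k p').lower (r := r) fun i hi => by
      rw [abs_sub_comm]; exact h i hi)
    exact abs_le.2 ⟨by omega, by omega⟩
  · refine strictMono_int_of_lt_succ fun k => ?_
    have := hLmax (k + 1) p _ (hL k p).succ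
    omega
  · exact le_antisymm ((hL k _).le hG hij) (hLmax k _ _ (underLayer_spine y hij hy))

end Layers

/-! ### Counting walks -/

section Counting

variable {ι : Type*} [Fintype ι] [DecidableEq ι]

/-- The displacements of a single step of a walk. -/
noncomputable def stepSet (ι : Type*) [Fintype ι] [DecidableEq ι] : Finset (ι → ℤ) :=
  Fintype.piFinset fun _ => Finset.Icc (-1) 1

/-- The endpoints and sets of visited sites of all walks of `n` steps from `u`. -/
noncomputable def walksFrom (u : ι → ℤ) : ℕ → Finset ((ι → ℤ) × Finset (ι → ℤ))
  | 0 => {(u, ∅), (u, {u})}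
  | n + 1 => (walksFrom u n ×ˢ stepSet ι).image (fun x => (x.1.1 + x.2, x.1.2)) ∪
      (walksFrom u n ×ˢ stepSet ι).image fun x => (x.1.1 + x.2, insert (x.1.1 + x.2) x.1.2)

/-- Repeated marking between steps adds nothing, so one optional mark per step suffices. -/
lemma insert_mem_walksFrom {u v : ι → ℤ} {n : ℕ} {C : Finset (ι → ℤ)}
    (h : (v, C) ∈ walksFrom u n) : (v, insert v C) ∈ walksFrom u n := by
  cases n with
  | zero =>
    simp only [walksFrom, Finset.mem_insert, Finset.mem_singleton, Prod.mk.injEq] at h ⊢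
    rcases h with ⟨rfl, rfl⟩ | ⟨rfl, rfl⟩ <;> simp
  | succ n =>
    simp only [walksFrom, Finset.mem_union, Finset.mem_image, Prod.mk.injEq] at h ⊢
    right
    rcases h with ⟨x, hx, rfl, rfl⟩ | ⟨x, hx, rfl, rfl⟩
    · exact ⟨x, hx, rfl, rfl⟩
    · exact ⟨x, hx, rfl, by simp⟩

lemma Walk.mem_walksFrom {u v : ι → ℤ} {n : ℕ} {C : Finset (ι → ℤ)} (h : Walk u v n C) :
    (v, C) ∈ walksFrom u n := by
  induction h with
  | nil => simp [walksFrom]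
  | @step v w n C _ hn ih =>
    simp only [walksFrom, Finset.mem_union, Finset.mem_image, Prod.mk.injEq]
    refine .inl ⟨((v, C), w - v), ?_, by simp, rfl⟩
    refine Finset.mem_product.2 ⟨ih, ?_⟩
    exact Fintype.mem_piFinset.2 fun i => Finset.mem_Icc.2 (abs_le.1 (by simpa using hn i))
  | mark _ ih => exact insert_mem_walksFrom ih

lemma card_walksFrom_le (u : ι → ℤ) (n : ℕ) :
    (walksFrom u n).card ≤ 2 * (2 * (stepSet ι).card) ^ n := by
  induction n with
  | zero => simp [walksFrom]
  | succ n ih =>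
    calc (walksFrom u (n + 1)).card
        ≤ (walksFrom u n ×ˢ stepSet ι).card + (walksFrom u n ×ˢ stepSet ι).card :=
          (Finset.card_union_le _ _).trans (add_le_add Finset.card_image_le Finset.card_image_le)
      _ = (walksFrom u n).card * (2 * (stepSet ι).card) := by rw [Finset.card_product]; ring
      _ ≤ 2 * (2 * (stepSet ι).card) ^ n * (2 * (stepSet ι).card) := by gcongr
      _ = _ := by ring

end Counting

/-! ### Sparsity of closed sites near `p = 1` -/

section Probability

open scoped ENNReal

lemma sitePercolation_forall_notMem {W : Type*} (p : I) (C : Finset W) :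
    sitePercolation W p {S | ∀ c ∈ C, c ∉ S} = (toNNReal (σ p) : ℝ≥0∞) ^ C.card := by
  rw [sitePercolation, setBernoulli_apply']
  have : (fun q : W → Prop => {i | q i}) ⁻¹' {S | ∀ c ∈ C, c ∉ S} =
      Set.pi C fun _ => {False} := by
    ext q
    simp [Set.mem_pi]
  rw [this, Measure.infinitePi_pi _ fun _ _ => measurableSet_singleton _]
  simp

variable {ι : Type*} [Fintype ι] [DecidableEq ι]

lemma measure_exists_walk_le (p : I) {t : ℝ≥0∞} (ht : (toNNReal (σ p) : ℝ≥0∞) ≤ t ^ 48)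
    (ht₁ : t ≤ 1) (u : ι → ℤ) (n : ℕ) :
    sitePercolation (ι → ℤ) p
      {S | ∃ v C, Walk u v n C ∧ n ≤ 48 * C.card ∧ ∀ c ∈ C, c ∉ S} ≤
      2 * (2 * (stepSet ι).card * t) ^ n := by
  set F := (walksFrom u n).filter fun x => n ≤ 48 * x.2.card
  calc _ ≤ sitePercolation (ι → ℤ) p (⋃ x ∈ F, {S | ∀ c ∈ x.2, c ∉ S}) := by
        refine measure_mono ?_
        rintro S ⟨v, C, hw, hn, hC⟩
        exact Set.mem_biUnion (x := (v, C)) (Finset.mem_filter.2 ⟨hw.mem_walksFrom, hn⟩) hC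
    _ ≤ ∑ x ∈ F, sitePercolation (ι → ℤ) p {S | ∀ c ∈ x.2, c ∉ S} :=
        measure_biUnion_finset_le _ _
    _ ≤ ∑ x ∈ F, t ^ n := by
        refine Finset.sum_le_sum fun x hx => ?_
        rw [sitePercolation_forall_notMem]
        calc _ ≤ (t ^ 48) ^ x.2.card := by gcongr
          _ = t ^ (48 * x.2.card) := (pow_mul _ _ _).symm
          _ ≤ t ^ n := pow_le_pow_right_of_le_one' ht₁ (Finset.mem_filter.1 hx).2
    _ ≤ (2 * (2 * (stepSet ι).card) ^ n : ℕ) * t ^ n := by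
        rw [Finset.sum_const, nsmul_eq_mul]
        gcongr
        exact (Finset.card_filter_le _ _).trans (card_walksFrom_le u n)
    _ = _ := by push_cast; rw [mul_assoc, mul_pow _ t]

lemma ae_sparseClosed (p : I) {t : ℝ≥0∞} (ht : (toNNReal (σ p) : ℝ≥0∞) ≤ t ^ 48) (ht₁ : t ≤ 1)
    (hsum : 2 * (stepSet ι).card * t < 1) :
    ∀ᵐ S ∂(sitePercolation (ι → ℤ) p), SparseClosed S := by
  refine ae_all_iff.2 fun u => ?_
  have hfin : ∑' n, sitePercolation (ι → ℤ) p
      {S | ∃ v C, Walk u v n C ∧ n ≤ 48 * C.card ∧ ∀ c ∈ C, c ∉ S} ≠ ∞ := by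
    refine ne_top_of_le_ne_top ?_ (ENNReal.tsum_le_tsum (measure_exists_walk_le p ht ht₁ u))
    rw [ENNReal.tsum_mul_left, ENNReal.tsum_geometric]
    exact ENNReal.mul_ne_top (by simp) (ENNReal.inv_ne_top.2 (tsub_pos_of_lt hsum).ne')
  filter_upwards [ae_eventually_notMem hfin] with S hS
  obtain ⟨N, hN⟩ := Filter.eventually_atTop.1 hS
  exact ⟨N, fun n hn v C hw hle hC => hN n hn ⟨v, C, hw, hle, hC⟩⟩

lemma exists_param (ι : Type*) [Fintype ι] [DecidableEq ι] : ∃ p₀ : I, p₀ < 1 ∧ ∀ p : I, p₀ < p →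
    ∀ᵐ S ∂(sitePercolation (ι → ℤ) p), SparseClosed S := by
  set K := (stepSet ι).card
  have hK : (0 : ℝ) < 2 * K + 1 := by positivity
  set t : ℝ := (2 * K + 1)⁻¹
  have ht : 0 < t := inv_pos.2 hK
  have ht₁ : t ≤ 1 := inv_le_one_of_one_le₀ (by linarith [(Nat.cast_nonneg K : (0 : ℝ) ≤ K)])
  have hp : t ^ 48 ∈ Set.Icc (0 : ℝ) 1 := ⟨by positivity, pow_le_one₀ ht.le ht₁⟩
  refine ⟨σ ⟨t ^ 48, hp⟩, ?_, fun p hlt => ae_sparseClosed p (t := ENNReal.ofReal t) ?_ ?_ ?_⟩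
  · rw [← Subtype.coe_lt_coe]
    simp [ht]
  · have : (σ p : ℝ) ≤ t ^ 48 := by
      have : (1 : ℝ) - t ^ 48 < p := hlt
      rw [coe_symm_eq]; linarith
    rw [← ENNReal.ofReal_pow ht.le, ← ENNReal.ofReal_coe_nnreal]
    exact ENNReal.ofReal_le_ofReal this
  · simpa using ENNReal.ofReal_le_ofReal ht₁
  · rw [show (2 * (K : ℝ≥0∞)) = ENNReal.ofReal (2 * K) by
      rw [ENNReal.ofReal_mul (by norm_num)]; simp, ← ENNReal.ofReal_mul (by positivity),
      ← ENNReal.ofReal_one, ENNReal.ofReal_lt_ofReal_iff (by norm_num)]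
    simp only [t]
    rw [← div_eq_mul_inv, div_lt_one hK]
    linarith

end Probability

/-! ### The embedding of the comb -/

section Embedding

lemma SparseClosed.exists_lipschitz_embedding {d : ℕ} (hd : 2 ≤ d) {S : Set (Fin d → ℤ)}
    (hS : SparseClosed S) :
    ∃ f : (Fin d → ℤ) → (Fin d → ℤ), Function.Injective f ∧ (∀ z, f z ∈ S) ∧
      ∀ z w, (combGraph d).Adj z w → ‖f z - f w‖ ≤ 2 := by
  set a : Fin d := ⟨0, by omega⟩
  set b : Fin d := ⟨d - 1, by omega⟩
  have hba : b ≠ a := by simp [a, b, Fin.ext_iff]; omega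
  obtain ⟨G, hGbad, hG⟩ := hS.exists_spine a b
  obtain ⟨L, hLS, hLip, hmono, hspine⟩ := exists_layers hGbad hba
  -- Doubling matches the layer spacing on the spine; the shift by `G` in `q` puts the teeth `z a =
  -- 0` there.
  set y : (Fin d → ℤ) → (Fin d → ℤ) := fun z => Function.update z b (2 * z b)
  set q : (Fin d → ℤ) → (Fin d → ℤ) := fun z => Function.update z a (z a + G (y z))
  set f : (Fin d → ℤ) → (Fin d → ℤ) := fun z => Function.update (q z) b (L (z b) (q z))
  have hfb : ∀ z, f z b = L (z b) (q z) := fun z => by simp [f]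
  have hfa : ∀ z, f z a = z a + G (y z) := fun z => by simp [f, q, hba.symm]
  have hfi : ∀ z i, i ≠ a → i ≠ b → f z i = z i := fun z i hia hib => by simp [f, q, hia, hib]
  have hq : ∀ z i, i ≠ b → q z i = f z i := fun z i hi => by simp [f, hi]
  have hLcongr : ∀ k p p', (∀ i, i ≠ b → p' i = p i) → L k p' = L k p := fun k p p' h => by
    have := hLip k 0 p p' fun i hi => by simp [h i hi]
    simp only [Nat.cast_zero, abs_nonpos_iff] at this
    omega
  have key : ∀ (z : Fin d → ℤ) (i : Fin d),
      (i ≠ b ∨ (i = b ∧ z a = 0)) → ‖f (z + Pi.single i 1) - f z‖ ≤ 2 := by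
    intro z i hi
    set w := z + Pi.single i 1
    have hwi : ∀ k, k ≠ i → w k = z k := fun k hk => by simp [w, hk]
    have hwi' : w i = z i + 1 := by simp [w]
    refine (pi_norm_le_iff_of_nonneg (by norm_num)).2 fun k => ?_
    rw [Int.norm_eq_abs, Pi.sub_apply]
    suffices |f w k - f z k| ≤ 2 by exact_mod_cast this
    rcases hi with hi | ⟨rfl, hza⟩
    · have hwb : w b = z b := hwi b hi.symm
      have hoff : ∀ k, k ≠ b → |f w k - f z k| ≤ 1 := by
        intro k hk
        by_cases hka : k = a
        · subst hka
          rw [hfa, hfa]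
          by_cases hia : i = a
          -- Radius 0: `G` does not depend on coordinate `a`.
          · have := hG 0 (y z) (y w) fun l hl => by
              by_cases hlb : l = b
              · subst hlb; simp [y, hwb]
              · simp [y, hlb, hwi l (by rw [hia]; exact hl)]
            rw [hia] at hwi'
            rw [abs_le] at this ⊢
            push_cast at this
            omega
          · have := hG 1 (y z) (y w) fun l hl => by
              by_cases hlb : l = b
              · subst hlb; simp [y, hwb]
              · by_cases hli : l = i
                · subst hli; simp [y, hlb, hwi']
                · simp [y, hlb, hwi l hli]
            rw [hwi a (Ne.symm hia)]
            rw [abs_le] at this ⊢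
            push_cast at this
            omega
        · rw [hfi _ k hka hk, hfi _ k hka hk]
          by_cases hki : k = i
          · subst hki; simp [hwi']
          · simp [hwi k hki]
      by_cases hkb : k = b
      · subst hkb
        rw [hfb, hfb, hwb]
        have := hLip (z b) 1 (q z) (q w) fun l hl => by
          rw [hq _ l hl, hq _ l hl]; exact_mod_cast hoff l hl
        push_cast at this
        linarith
      · linarith [hoff k hkb]
    · have hwa : w a = 0 := by rw [hwi a hba.symm, hza]
      have hLspine : ∀ x : Fin d → ℤ, x a = 0 → f x b = 2 * x b := fun x hx => by
        rw [hfb, ← hspine (x b) (y x) (by simp [y])]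
        refine hLcongr _ _ _ fun l hl => ?_
        by_cases hla : l = a
        · subst hla; simp [q, hx]
        · simp [q, y, hl, hla]
      by_cases hkb : k = b
      · subst hkb
        rw [hLspine w hwa, hLspine z hza, hwi']
        ring_nf
        norm_num
      · by_cases hka : k = a
        · subst hka
          rw [hfa, hfa, hwa, hza]
          have := hG 2 (y z) (y w) fun l hl => by
            by_cases hlb : l = b
            · subst hlb; simp [y, hwi']; ring_nf; norm_num
            · simp [y, hlb, hwi l hlb]
          simpa using this
        · rw [hfi _ k hka hkb, hfi _ k hka hkb, hwi k hkb]
          simp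
  refine ⟨f, fun z w hzw => ?_, fun z => hLS _ _, fun z w hzw => ?_⟩
  · have hqzw : ∀ i, i ≠ b → q w i = q z i := fun i hi => by rw [hq _ i hi, hq _ i hi, hzw]
    -- Equal images lie in one column, where strict monotonicity recovers the layer.
    have hL : L (z b) (q z) = L (w b) (q z) := by
      rw [← hLcongr (w b) (q z) (q w) hqzw, ← hfb, ← hfb, hzw]
    have hb : z b = w b := (hmono (q z)).injective hL
    have hne : ∀ i, i ≠ a → z i = w i := fun i hia => by
      by_cases hib : i = b
      · rw [hib, hb]
      · rw [← hfi z i hia hib, ← hfi w i hia hib, hzw]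
    funext i
    by_cases hia : i = a
    · subst hia
      have h₁ := hG 0 (y z) (y w) fun l hl => by
        by_cases hlb : l = b
        · subst hlb; simp [y, hb]
        · simp [y, hlb, hne l hl]
      simp only [Nat.cast_zero, abs_nonpos_iff] at h₁
      have h₂ := congrFun hzw a
      rw [hfa, hfa] at h₂
      omega
    · exact hne i hia
  · have hcase : ∀ (x : Fin d → ℤ) (i : Fin d),
        (i.val + 1 < d ∨ (i.val + 1 = d ∧ ∀ j : Fin d, j.val = 0 → x j = 0)) →
        i ≠ b ∨ (i = b ∧ x a = 0) := by
      rintro x i (h | ⟨h, h'⟩)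
      · left; simp only [b, ne_eq, Fin.ext_iff]; omega
      · right; exact ⟨Fin.ext (by simp only [b]; omega), h' a rfl⟩
    rw [combGraph, SimpleGraph.fromRel_adj] at hzw
    rcases hzw.2 with ⟨i, rfl, h⟩ | ⟨i, rfl, h⟩
    · rw [norm_sub_rev]; exact key z i (hcase z i h)
    · exact key w i (hcase w i h)

lemma criticalProb_le {V W : Type*} {G : SimpleGraph V} {H : SimpleGraph W} {p : I}
    (h : ∀ᵐ S ∂(sitePercolation W p), EmbedsInOpenSet G H S) : criticalProb G H ≤ p := by
  refine sInf_le (Set.mem_ofPred_eq ▸ pos_iff_ne_zero.2 fun h₀ => ?_)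
  have : IsProbabilityMeasure (sitePercolation W p) := by unfold sitePercolation; infer_instance
  -- Subadditivity avoids measurability of the embedding event.
  have := measure_union_le (μ := sitePercolation W p) {S | EmbedsInOpenSet G H S}
    {S | EmbedsInOpenSet G H S}ᶜ
  rw [Set.union_compl_self, measure_univ, h₀, mem_ae_iff.1 h] at this
  simp at this

end Embedding

end CombPercolation

theorem theorem1 (d : ℕ) (hd : 2 ≤ d) :
    criticalProb (combGraph d) (spreadOutLattice d 2) < 1 ∧
    ∃ p₀ : I, p₀ < 1 ∧ ∀ p : I, p₀ < p →
      ∀ᵐ S ∂(sitePercolation (Fin d → ℤ) p),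
        ∃ f : (Fin d → ℤ) → (Fin d → ℤ), Function.Injective f ∧ (∀ z, f z ∈ S) ∧
          ∀ z w, (combGraph d).Adj z w → ‖f z - f w‖ ≤ 2 := by
  obtain ⟨p₀, hp₀, h⟩ := CombPercolation.exists_param (Fin d)
  refine ⟨?_, p₀, hp₀, fun p hp => (h p hp).mono fun S hS => hS.exists_lipschitz_embedding hd⟩
  obtain ⟨p, hp, hp₁⟩ := exists_between hp₀
  refine (CombPercolation.criticalProb_le ((h p hp).mono fun S hS => ?_)).trans_lt hp₁
  obtain ⟨f, hf, hfS, hadj⟩ := hS.exists_lipschitz_embedding hd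
  refine ⟨f, hf, hfS, fun z w hzw => ⟨?_, by exact_mod_cast hadj z w hzw⟩⟩
  exact norm_pos_iff.2 (sub_ne_zero.2 fun h => hzw.ne (hf h))
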